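/- Let $B=(B_t)_{t\in[0,1]}$ be a fractional Brownian motion with Hurst parameter $H\in(1/2,1)$ on a probability space, that is, a centered Gaussian process with almost surely continuous paths and covariance $\mathbf{E}B_sB_t=\frac12\left(s^{2H}+t^{2H}-|t-s|^{2H}\right)$. Let $a\in C^2(\mathbb{R})$ and $\sigma\in C^3(\mathbb{R})$ be bounded, with bounded derivatives (up to order $2$ and $3$, respectively), and let $\inf_{x\in\mathbb{R}}\sigma(x)>0$. Let $x_0\in\mathbb{R}$ and let $X=(X_t)_{t\in[0,1]}$ be a process with almost surely continuous paths which almost surely solves the pathwise Riemann–Stieltjes integral equation $$X_t=x_0+\int_0^t a(X_\tau)\,d\tau+\int_0^t\sigma(X_\tau)\,dB_\tau,\qquad t\in[0,1]$$ (in particular the Riemann–Stieltjes integrals exist). Assume that $a'(x)\sigma(x)-a(x)\sigma'(x)=0$ for all $x\in\mathbb{R}$. Then there is a measurable function $\varphi:\mathbb{R}\to\mathbb{R}$ with $X_1=\varphi(B_1)$ almost surely, $X_1$ is square integrable, and for every integer $n\ge1$ the conditional expectation $\overline{X}^{(n)}_1=\mathbf{E}\left(X_1\mid B_{1/n},B_{2/n},\ldots,B_1\right)$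 satisfies $$\overline{X}^{(n)}_1=X_1\ \text{ almost surely, and }\ \left(\mathbf{E}\left|X_1-\overline{X}^{(n)}_1\right|^2\right)^{1/2}=0.$$ -/

import Mathlib

open MeasureTheory ProbabilityTheory

/-- The Riemann-Stieltjes integral of `f` with respect to `g` over `[a, b]` exists and equals `I`:
the Riemann-Stieltjes sums over tagged partitions `a = t 0 ≤ ... ≤ t m = b` with tags
`ξ i ∈ [t i, t (i + 1)]` converge to `I` as the mesh tends to zero. -/
def HasRSIntegral (f g : ℝ → ℝ) (a b I : ℝ) : Prop :=
  a ≤ b ∧ ∀ ε > 0, ∃ δ > 0, ∀ (m : ℕ) (t ξ : ℕ → ℝ), t 0 = a → t m = b →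
    (∀ i < m, ξ i ∈ Set.Icc (t i) (t (i + 1)) ∧ t (i + 1) - t i < δ) →
    |∑ i ∈ Finset.range m, f (ξ i) * (g (t (i + 1)) - g (t i)) - I| < ε

/-- `(B t)`, `t ∈ [0, 1]`, is a fractional Brownian motion with Hurst parameter `H`: a centered
Gaussian process with (almost surely) continuous paths and covariance
`(s ^ (2H) + t ^ (2H) - |t - s| ^ (2H)) / 2`. Values of `B` outside `[0, 1]` play no role. -/
structure IsFractionalBrownianMotion {Ω : Type*} [MeasurableSpace Ω] (μ : Measure Ω) (H : ℝ)
    (B : ℝ → Ω → ℝ) : Prop where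
  measurable : ∀ t ∈ Set.Icc (0 : ℝ) 1, Measurable (B t)
  gaussian : IsGaussianProcess (fun t : Set.Icc (0 : ℝ) 1 => B t) μ
  centered : ∀ t ∈ Set.Icc (0 : ℝ) 1, ∫ ω, B t ω ∂μ = 0
  covariance_eq : ∀ s ∈ Set.Icc (0 : ℝ) 1, ∀ t ∈ Set.Icc (0 : ℝ) 1,
    cov[B s, B t; μ] = (1 / 2) * (s ^ (2 * H) + t ^ (2 * H) - |t - s| ^ (2 * H))
  continuous : ∀ᵐ ω ∂μ, ContinuousOn (fun t => B t ω) (Set.Icc 0 1)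

/-- `(X t)`, `t ∈ [0, 1]`, is a (continuous) solution of `dX = a(X) dt + σ(X) dB`, `X 0 = x₀`,
understood as a pathwise Riemann-Stieltjes integral equation. The existence of the
Riemann-Stieltjes integrals is part of being a solution. -/
structure IsPathwiseSolution {Ω : Type*} [MeasurableSpace Ω] (μ : Measure Ω) (a σ : ℝ → ℝ)
    (x₀ : ℝ) (B X : ℝ → Ω → ℝ) : Prop where
  measurable : ∀ t ∈ Set.Icc (0 : ℝ) 1, Measurable (X t)
  continuous : ∀ᵐ ω ∂μ, ContinuousOn (fun t => X t ω) (Set.Icc 0 1)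
  equation : ∀ᵐ ω ∂μ, ∀ t ∈ Set.Icc (0 : ℝ) 1, ∃ I : ℝ,
    HasRSIntegral (fun τ => σ (X τ ω)) (fun τ => B τ ω) 0 t I ∧
      X t ω = x₀ + (∫ τ in (0 : ℝ)..t, a (X τ ω)) + I

/-- Standing assumptions on the coefficients: `a` is `C²` and `σ` is `C³`, with bounded derivatives,
both are bounded, and `inf σ > 0`. -/
structure CoefficientAssumptions (a σ : ℝ → ℝ) : Prop where
  contDiff_a : ContDiff ℝ 2 a
  contDiff_σ : ContDiff ℝ 3 σ
  bounded_deriv_a : ∀ k : ℕ, 1 ≤ k → k ≤ 2 → ∃ C : ℝ, ∀ x, |iteratedDeriv k a x| ≤ C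
  bounded_deriv_σ : ∀ k : ℕ, 1 ≤ k → k ≤ 3 → ∃ C : ℝ, ∀ x, |iteratedDeriv k σ x| ≤ C
  bounded_a : ∃ C : ℝ, ∀ x, |a x| ≤ C
  bounded_σ : ∃ C : ℝ, ∀ x, |σ x| ≤ C
  inf_pos : ∃ c : ℝ, 0 < c ∧ ∀ x, c ≤ σ x

/-- The σ-algebra generated by `B (1/n), B (2/n), ..., B 1`. -/
noncomputable abbrev gridSigmaAlgebra {Ω : Type*} (B : ℝ → Ω → ℝ) (n : ℕ) : MeasurableSpace Ω :=
  ⨆ i ∈ Finset.Icc 1 n, MeasurableSpace.comap (B ((i : ℝ) / (n : ℝ))) inferInstance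

/-- `E(X 1 | B (1/n), B (2/n), ..., B 1)`. -/
noncomputable def optimalApprox {Ω : Type*} [MeasurableSpace Ω] (μ : Measure Ω)
    (B X : ℝ → Ω → ℝ) (n : ℕ) : Ω → ℝ :=
  μ[X 1 | gridSigmaAlgebra B n]

/-! The commutation condition says `(a/σ)' = 0`, so `a = c * σ`. With `G' = 1/σ` and `G x₀ = 0`, the
chain rule turns the equation into `G(X₁) = c + B₁`. As `G` is injective, `X₁` is a measurable
function of `B₁`, hence measurable for every grid σ-algebra, and conditioning leaves it unchanged.

The work lies in the chain rule (`change_of_variables`), since nothing beyond continuity of `X` and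
existence of the integrals is assumed. A Taylor expansion leaves the summed squared increments of
`X`. A Saks-Henstock estimate makes the total deviation of the integral increments from `σ(X) ΔB`
small, so the squares are controlled by the quadratic variation of `B`. Its mean over `n` equal
steps is `n ^ (1 - 2H)`, which tends to `0` because `H > 1/2`; Fatou then gives lower limit zero
almost surely, and this suffices. -/

/-! ### Riemann-Stieltjes sums and the Saks-Henstock estimate -/

/-- `S` is a Riemann-Stieltjes sum of `f` against `g` over a tagged partition of `[a, b]` of mesh
less than `δ`. -/
def IsRSSum (f g : ℝ → ℝ) (δ a b S : ℝ) : Prop :=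
  ∃ (m : ℕ) (t ξ : ℕ → ℝ), t 0 = a ∧ t m = b ∧
    (∀ i < m, ξ i ∈ Set.Icc (t i) (t (i + 1)) ∧ t (i + 1) - t i < δ) ∧
    ∑ i ∈ Finset.range m, f (ξ i) * (g (t (i + 1)) - g (t i)) = S

namespace IsRSSum

variable {f g : ℝ → ℝ} {δ a b c S T : ℝ}

lemma nil (f g : ℝ → ℝ) (δ a : ℝ) : IsRSSum f g δ a a 0 :=
  ⟨0, fun _ => a, fun _ => a, rfl, rfl, by simp, by simp⟩

lemma single {ξ : ℝ} (hξ : ξ ∈ Set.Icc a b) (hδ : b - a < δ) :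
    IsRSSum f g δ a b (f ξ * (g b - g a)) :=
  ⟨1, fun i => if i = 0 then a else b, fun _ => ξ, by simp, by simp, by
    intro i hi
    obtain rfl : i = 0 := by omega
    simpa using ⟨hξ, hδ⟩, by simp⟩

lemma mono {δ' : ℝ} (h : IsRSSum f g δ a b S) (hδ : δ ≤ δ') : IsRSSum f g δ' a b S := by
  obtain ⟨m, t, ξ, h0, hm, h, hS⟩ := h
  exact ⟨m, t, ξ, h0, hm, fun i hi => ⟨(h i hi).1, (h i hi).2.trans_le hδ⟩, hS⟩

lemma append (h₁ : IsRSSum f g δ a b S) (h₂ : IsRSSum f g δ b c T) :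
    IsRSSum f g δ a c (S + T) := by
  obtain ⟨m, t, ξ, h0, hm, h, rfl⟩ := h₁
  obtain ⟨n, u, η, k0, kn, k, rfl⟩ := h₂
  -- At the junction `i = m` the second branch applies; it agrees because `u 0 = b = t m`.
  have ht : ∀ i ≤ m, (if i < m then t i else u (i - m)) = t i := by
    intro i hi
    split_ifs with hlt
    · rfl
    · obtain rfl : i = m := by omega
      simp [k0, hm]
  refine ⟨m + n, fun i => if i < m then t i else u (i - m),
    fun i => if i < m then ξ i else η (i - m), ?_, ?_, ?_, ?_⟩
  · exact (ht 0 (Nat.zero_le _)).trans h0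
  · simp [kn]
  · intro i hi
    by_cases hlt : i < m
    · simp only [ht (i + 1) hlt, hlt, if_true]
      exact h i hlt
    · have h1 : ¬ i + 1 < m := by omega
      have h2 : i + 1 - m = i - m + 1 := by omega
      simp only [hlt, h1, if_false, h2]
      exact k _ (by omega)
  · rw [Finset.sum_range_add]
    congr 1
    · refine Finset.sum_congr rfl fun i hi => ?_
      have hlt := Finset.mem_range.1 hi
      simp only [ht (i + 1) hlt, hlt, if_true]
    · refine Finset.sum_congr rfl fun i _ => ?_
      have h1 : ¬ m + i < m := by omega
      have h2 : ¬ m + i + 1 < m := by omega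
      have h3 : m + i + 1 - m = i + 1 := by omega
      have h4 : m + i - m = i := by omega
      simp only [h1, h2, h3, h4, if_false]

lemma exists_of_le (f g : ℝ → ℝ) (hδ : 0 < δ) (hab : a ≤ b) : ∃ S, IsRSSum f g δ a b S := by
  obtain ⟨n, hn⟩ := exists_nat_gt ((b - a) / δ)
  have hn0 : (0 : ℝ) < n := (div_nonneg (sub_nonneg.2 hab) hδ.le).trans_lt hn
  have hstep : (b - a) / n < δ := by
    rw [div_lt_iff₀ hδ] at hn
    rw [div_lt_iff₀ hn0]
    linarith
  have hnonneg : 0 ≤ (b - a) / n := div_nonneg (sub_nonneg.2 hab) hn0.le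
  refine ⟨_, n, fun i => a + i * ((b - a) / n), fun i => a + i * ((b - a) / n), by simp, ?_, ?_,
    rfl⟩
  · simp only
    field_simp
    ring
  · intro i _
    refine ⟨⟨le_rfl, ?_⟩, ?_⟩ <;> push_cast <;> linarith

end IsRSSum

namespace HasRSIntegral

variable {f g : ℝ → ℝ} {a b c I J : ℝ}

lemma exists_mesh (h : HasRSIntegral f g a b I) {ε : ℝ} (hε : 0 < ε) :
    ∃ δ > 0, ∀ S, IsRSSum f g δ a b S → |S - I| < ε := by
  obtain ⟨δ, hδ, H⟩ := h.2 ε hε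
  refine ⟨δ, hδ, ?_⟩
  rintro S ⟨m, t, ξ, h0, hm, ht, rfl⟩
  exact H m t ξ h0 hm ht

lemma eq_zero_of_refl (h : HasRSIntegral f g a a I) : I = 0 := by
  by_contra hI
  obtain ⟨δ, -, H⟩ := h.exists_mesh (abs_pos.2 hI)
  simpa using H 0 (IsRSSum.nil f g δ a)

/-- A fine sum over `[a, b]` followed by one over `[b, c]` is a fine sum over `[a, c]`; subtracting
the two limits avoids proving integrability on `[b, c]`. -/
lemma exists_isRSSum_sub (hI : HasRSIntegral f g a b I) (hJ : HasRSIntegral f g a c J)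
    (hbc : b ≤ c) {δ η : ℝ} (hδ : 0 < δ) (hη : 0 < η) :
    ∃ S, IsRSSum f g δ b c S ∧ |S - (J - I)| < η := by
  obtain ⟨δ₁, hδ₁, H₁⟩ := hI.exists_mesh (half_pos hη)
  obtain ⟨δ₂, hδ₂, H₂⟩ := hJ.exists_mesh (half_pos hη)
  obtain ⟨S, hS⟩ := IsRSSum.exists_of_le f g (lt_min hδ₁ hδ₂) hI.1
  obtain ⟨T, hT⟩ := IsRSSum.exists_of_le f g (lt_min hδ hδ₂) hbc
  refine ⟨T, hT.mono (min_le_left _ _), ?_⟩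
  have h₁ := abs_lt.1 (H₁ S (hS.mono (min_le_left _ _)))
  have h₂ := abs_lt.1 (H₂ _ ((hS.mono (min_le_right _ _)).append (hT.mono (min_le_right _ _))))
  rw [abs_lt]
  constructor <;> linarith

/-- The Saks-Henstock lemma for the Riemann-Stieltjes integral along uniform partitions of
`[0, 1]`. -/
lemma exists_mesh_sum_abs_le {J : ℝ → ℝ}
    (h : ∀ t ∈ Set.Icc (0 : ℝ) 1, HasRSIntegral f g 0 t (J t)) {ε : ℝ} (hε : 0 < ε) :
    ∃ N : ℕ, ∀ n ≥ N, ∑ i ∈ Finset.range n, |J ((i + 1 : ℕ) / n) - J (i / n) -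
      f (i / n) * (g ((i + 1 : ℕ) / n) - g (i / n))| ≤ ε := by
  obtain ⟨δ, hδ, H⟩ := (h 1 (by simp)).exists_mesh (half_pos hε)
  obtain ⟨N, hN⟩ := exists_nat_gt (1 / δ)
  refine ⟨N, fun n hn => ?_⟩
  have hn1 : 1 / δ < n := hN.trans_le (by exact_mod_cast hn)
  have hn0 : (0 : ℝ) < n := (by positivity : 0 < 1 / δ).trans hn1
  have hstep : 1 / (n : ℝ) < δ := by rwa [one_div_lt hn0 hδ]
  set r : ℕ → ℝ := fun i => J ((i + 1 : ℕ) / n) - J (i / n) -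
      f (i / n) * (g ((i + 1 : ℕ) / n) - g (i / n)) with hr
  have hle : ∀ i : ℕ, (i : ℝ) / n ≤ (i + 1 : ℕ) / n := fun i => by
    gcongr; exact Nat.le_succ i
  have hmem : ∀ i : ℕ, i ≤ n → (i : ℝ) / n ∈ Set.Icc (0 : ℝ) 1 := fun i hi =>
    ⟨by positivity, by rw [div_le_one hn0]; exact_mod_cast hi⟩
  -- Use the one-term sum on the cells selected by `A` and a nearly exact fine sum on the others:
  -- the resulting sum misses the integral by the `A`-part of the `r i`, up to `η` per cell.
  have key : ∀ (A : ℕ → Prop) [DecidablePred A] (η : ℝ), 0 < η → ∀ k ≤ n, ∃ S,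
      IsRSSum f g δ 0 ((k : ℝ) / n) S ∧
      |S - (J (k / n) - ∑ i ∈ Finset.range k, if A i then r i else 0)| ≤ k * η := by
    intro A _ η hη k
    induction k with
    | zero =>
      intro _
      refine ⟨0, by simpa using IsRSSum.nil f g δ 0, ?_⟩
      have := (h 0 (by simp)).eq_zero_of_refl
      simp [this]
    | succ k ih =>
      intro hk
      obtain ⟨S, hS, hSe⟩ := ih (by omega)
      rw [Finset.sum_range_succ]
      by_cases hA : A k
      · refine ⟨_, hS.append (IsRSSum.single (Set.left_mem_Icc.2 (hle k)) ?_), ?_⟩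
        · push_cast
          rw [add_div]
          linarith
        · rw [if_pos hA, hr]
          refine le_trans (le_of_eq ?_) (hSe.trans ?_)
          · congr 1
            ring
          · push_cast
            linarith
      · obtain ⟨T, hT, hTe⟩ := exists_isRSSum_sub (h _ (hmem k (by omega))) (h _ (hmem _ hk))
          (hle k) hδ hη
        refine ⟨_, hS.append hT, ?_⟩
        rw [if_neg hA]
        have h1 := abs_le.1 hSe
        have h2 := abs_lt.1 hTe
        push_cast at h2 ⊢
        rw [abs_le]
        constructor <;> linarith
  have part : ∀ (A : ℕ → Prop) [DecidablePred A],
      |∑ i ∈ Finset.range n, if A i then r i else 0| ≤ ε / 2 := by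
    intro A _
    refine le_of_forall_pos_le_add fun η hη => ?_
    obtain ⟨S, hS, hSe⟩ := key A (η / n) (by positivity) n le_rfl
    rw [div_self hn0.ne'] at hS hSe
    rw [mul_div_cancel₀ _ hn0.ne'] at hSe
    have h1 := abs_lt.1 (H S hS)
    have h2 := abs_le.1 hSe
    rw [abs_le]
    constructor <;> linarith
  -- Selecting the cells by the sign of `r i` bounds the sum of absolute values.
  have hp := part (fun i => 0 ≤ r i)
  have hm := part (fun i => ¬ 0 ≤ r i)
  have : ∑ i ∈ Finset.range n, |r i| = (∑ i ∈ Finset.range n, if 0 ≤ r i then r i else 0) -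
      ∑ i ∈ Finset.range n, if ¬ 0 ≤ r i then r i else 0 := by
    rw [← Finset.sum_sub_distrib]
    refine Finset.sum_congr rfl fun i _ => ?_
    by_cases hi : 0 ≤ r i
    · simp [hi]
    · simp [hi, abs_of_neg (not_le.1 hi)]
  rw [this]
  have h1 := abs_le.1 hp
  have h2 := abs_le.1 hm
  linarith

end HasRSIntegral

/-! ### Pathwise change of variables -/

/-- The quadratic variation of `b` along the uniform partition of `[0, 1]` into `n` intervals. -/
noncomputable def uniformQuadVar (b : ℝ → ℝ) (n : ℕ) : ℝ :=
  ∑ i ∈ Finset.range n, (b ((i + 1 : ℕ) / n) - b (i / n)) ^ 2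

/-- The second order Taylor bound for a function with Lipschitz derivative. -/
lemma abs_sub_sub_deriv_mul_le {G G' : ℝ → ℝ} {K : ℝ} (hG : ∀ x, HasDerivAt G (G' x) x)
    (hK : ∀ x y, |G' x - G' y| ≤ K * |x - y|) (x y : ℝ) :
    |G y - G x - G' x * (y - x)| ≤ K * (y - x) ^ 2 := by
  have hK0 : 0 ≤ K := by simpa using (abs_nonneg _).trans (hK 1 0)
  -- Mean value inequality for `z ↦ G z - G' x * z`: it loses the factor `1/2` but needs no second
  -- derivative.
  have := (convex_uIcc x y).norm_image_sub_le_of_norm_hasDerivWithin_le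
    (f := fun z => G z - G' x * z) (f' := fun z => G' z - G' x) (C := K * |y - x|)
    (fun z _ => by
      simpa using ((hG z).fun_sub ((hasDerivAt_id z).const_mul (G' x))).hasDerivWithinAt)
    (fun z hz => (hK z x).trans (mul_le_mul_of_nonneg_left (Set.abs_sub_left_of_mem_uIcc hz) hK0))
    Set.left_mem_uIcc Set.right_mem_uIcc
  rw [Real.norm_eq_abs, Real.norm_eq_abs] at this
  calc _ = |G y - G' x * y - (G x - G' x * x)| := by congr 1; ring
    _ ≤ K * |y - x| * |y - x| := this
    _ = _ := by rw [mul_assoc, abs_mul_abs_self]; ring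

/-- Change of variables for a Riemann-Stieltjes equation driven by a path whose quadratic
variation along uniform partitions has vanishing lower limit. -/
theorem change_of_variables {σ G x b : ℝ → ℝ} {c c₀ Cσ L x₀ : ℝ} (hc₀ : 0 < c₀)
    (hσ : ∀ y, c₀ ≤ σ y) (hCσ : ∀ y, σ y ≤ Cσ) (hL : ∀ y z, |σ y - σ z| ≤ L * |y - z|)
    (hG : ∀ y, HasDerivAt G (1 / σ y) y)
    (hx : ContinuousOn x (Set.Icc 0 1))
    (heq : ∀ t ∈ Set.Icc (0 : ℝ) 1, ∃ I : ℝ,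
      HasRSIntegral (fun τ => σ (x τ)) b 0 t I ∧
        x t = x₀ + (∫ τ in (0 : ℝ)..t, c * σ (x τ)) + I)
    (hb : ∀ ε > 0, ∃ᶠ n in Filter.atTop, uniformQuadVar b n < ε) :
    G (x 1) - G x₀ = c + b 1 - b 0 := by
  choose! J hJ hxJ using heq
  have hx0 : x 0 = x₀ := by
    rw [hxJ 0 (by simp), (hJ 0 (by simp)).eq_zero_of_refl]
    simp
  have hL0 : 0 ≤ L := by simpa using (abs_nonneg _).trans (hL 1 0)
  have hCσ0 : 0 < Cσ := hc₀.trans_le ((hσ 0).trans (hCσ 0))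
  set K : ℝ := L / c₀ ^ 2 with hKdef
  have hK0 : 0 ≤ K := by positivity
  have hK : ∀ y z, |1 / σ y - 1 / σ z| ≤ K * |y - z| := by
    intro y z
    have hy := hc₀.trans_le (hσ y)
    have hz := hc₀.trans_le (hσ z)
    have : 1 / σ y - 1 / σ z = (σ z - σ y) / (σ y * σ z) := by field_simp
    rw [this, abs_div, abs_of_pos (mul_pos hy hz), hKdef, div_mul_eq_mul_div]
    have h1 := hL z y
    rw [abs_sub_comm z y] at h1
    have : c₀ ^ 2 ≤ σ y * σ z := by
      rw [sq]; exact mul_le_mul (hσ y) (hσ z) hc₀.le hy.le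
    gcongr
  have hInt : ∀ s ∈ Set.Icc (0 : ℝ) 1, ∀ t ∈ Set.Icc (0 : ℝ) 1,
      IntervalIntegrable (fun τ => σ (x τ)) volume s t := by
    have hσc : Continuous σ := by
      refine (LipschitzWith.of_dist_le_mul (K := L.toNNReal) fun y z => ?_).continuous
      simpa [Real.dist_eq, hL0] using hL y z
    intro s hs t ht
    exact ((hσc.comp_continuousOn hx).mono (Set.uIcc_subset_Icc hs ht)).intervalIntegrable
  rw [← sub_eq_zero, ← abs_eq_zero]
  refine le_antisymm ?_ (abs_nonneg _)
  -- an error bound that vanishes with `ε`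
  have bound : ∀ ε > 0, |G (x 1) - G x₀ - (c + b 1 - b 0)| ≤
      ε * (1 / c₀) + |c| * L * ε * (1 / c₀) +
        K * (3 * (ε ^ 2 + Cσ ^ 2 * ε + (|c| * Cσ) ^ 2 * ε)) := by
    intro ε hε
    obtain ⟨N, hN⟩ := HasRSIntegral.exists_mesh_sum_abs_le hJ hε
    obtain ⟨δ, hδ, hunif⟩ := Metric.uniformContinuousOn_iff.1
      (isCompact_Icc.uniformContinuousOn_of_continuous hx) ε hε
    obtain ⟨N₁, hN₁⟩ := exists_nat_gt (1 / δ)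
    obtain ⟨N₂, hN₂⟩ := exists_nat_gt (1 / ε)
    -- `N` serves the Saks-Henstock bound, `N₁` brings the mesh below `δ`, `N₂` gives `1/n ≤ ε`, and
    -- `+ 1` keeps `n` positive.
    obtain ⟨n, hn, hQ⟩ := Filter.frequently_atTop.1 (hb ε hε) (N + N₁ + N₂ + 1)
    have hn0 : (0 : ℝ) < n := by
      have : 0 < n := by omega
      exact_mod_cast this
    have hnδ : 1 / (n : ℝ) < δ := by
      rw [one_div_lt hn0 hδ]
      exact hN₁.trans_le (by exact_mod_cast (by omega : N₁ ≤ n))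
    have hnε : 1 / (n : ℝ) ≤ ε := by
      rw [one_div_le hn0 hε]
      exact hN₂.le.trans (by exact_mod_cast (by omega : N₂ ≤ n))
    have hr := hN n (by omega)
    set s : ℕ → ℝ := fun i => (i : ℝ) / n with hs
    have hsmem : ∀ i ≤ n, s i ∈ Set.Icc (0 : ℝ) 1 := fun i hi =>
      ⟨by positivity, by simp only [hs]; rw [div_le_one hn0]; exact_mod_cast hi⟩
    have hstep : ∀ i, s (i + 1) - s i = 1 / n := fun i => by
      simp only [hs]; push_cast; ring
    set r : ℕ → ℝ := fun i => J (s (i + 1)) - J (s i) - σ (x (s i)) * (b (s (i + 1)) - b (s i))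
    set d : ℕ → ℝ := fun i => ∫ τ in s i..s (i + 1), c * σ (x τ)
    have hr' : ∑ i ∈ Finset.range n, |r i| ≤ ε := hr
    have hQ' : ∑ i ∈ Finset.range n, (b (s (i + 1)) - b (s i)) ^ 2 < ε := hQ
    have hinc : ∀ i < n, x (s (i + 1)) - x (s i) =
        r i + σ (x (s i)) * (b (s (i + 1)) - b (s i)) + d i := by
      intro i hi
      have h0 : (0 : ℝ) ∈ Set.Icc (0 : ℝ) 1 := by simp
      have h1 := hsmem i hi.le
      have h2 := hsmem (i + 1) hi
      have := intervalIntegral.integral_add_adjacent_intervals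
        ((hInt 0 h0 _ h1).const_mul c) ((hInt _ h1 _ h2).const_mul c)
      have e1 := hxJ _ h1
      have e2 := hxJ _ h2
      simp only [r, d]
      linarith
    have hd : ∀ i < n, |d i| ≤ |c| * Cσ * (1 / n) := by
      intro i hi
      have := intervalIntegral.norm_integral_le_of_norm_le_const (a := s i) (b := s (i + 1))
        (f := fun τ => c * σ (x τ)) (C := |c| * Cσ) (fun τ _ => by
          rw [norm_mul, Real.norm_eq_abs, Real.norm_eq_abs,
            abs_of_pos (hc₀.trans_le (hσ _))]
          gcongr
          exact hCσ _)
      rwa [hstep, Real.norm_eq_abs, abs_of_pos (by positivity : (0 : ℝ) < 1 / n)] at this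
    have hd' : ∀ i < n, |d i - c * σ (x (s i)) * (1 / n)| ≤ |c| * L * ε * (1 / n) := by
      intro i hi
      have h1 := hsmem i hi.le
      have h2 := hsmem (i + 1) hi
      have hlt : s i ≤ s (i + 1) := by
        have := hstep i
        have : (0 : ℝ) < 1 / n := by positivity
        linarith
      have heq : d i - c * σ (x (s i)) * (1 / n) =
          ∫ τ in s i..s (i + 1), (c * σ (x τ) - c * σ (x (s i))) := by
        rw [intervalIntegral.integral_sub ((hInt _ h1 _ h2).const_mul c) (by simp),
          intervalIntegral.integral_const, hstep, smul_eq_mul]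
        ring
      have := intervalIntegral.norm_integral_le_of_norm_le_const (a := s i) (b := s (i + 1))
        (f := fun τ => c * σ (x τ) - c * σ (x (s i))) (C := |c| * L * ε) (fun τ hτ => by
          rw [Set.uIoc_of_le hlt] at hτ
          have hτm : τ ∈ Set.Icc (0 : ℝ) 1 := ⟨h1.1.trans hτ.1.le, hτ.2.trans h2.2⟩
          have hdist : dist τ (s i) < δ := by
            rw [Real.dist_eq, abs_of_pos (sub_pos.2 hτ.1)]
            linarith [hτ.2, hstep i]
          have hxd := (hunif τ hτm (s i) h1 hdist).le
          rw [Real.dist_eq] at hxd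
          rw [← mul_sub, norm_mul, Real.norm_eq_abs, Real.norm_eq_abs, mul_assoc]
          gcongr
          exact (hL _ _).trans (by gcongr))
      rw [heq]
      rwa [hstep, Real.norm_eq_abs, abs_of_pos (by positivity : (0 : ℝ) < 1 / n)] at this
    have htel : G (x 1) - G x₀ - (c + b 1 - b 0) = ∑ i ∈ Finset.range n,
        (G (x (s (i + 1))) - G (x (s i)) - (c * (1 / n) + (b (s (i + 1)) - b (s i)))) := by
      rw [Finset.sum_sub_distrib, Finset.sum_add_distrib, Finset.sum_range_sub (fun i => b (s i)),
        Finset.sum_range_sub (fun i => G (x (s i)))]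
      have hsn : s n = 1 := div_self hn0.ne'
      have hs0 : s 0 = 0 := by simp [hs]
      simp only [Finset.sum_const, Finset.card_range, nsmul_eq_mul, hsn, hs0, hx0]
      field_simp
      ring
    have hterm : ∀ i ∈ Finset.range n,
        |G (x (s (i + 1))) - G (x (s i)) - (c * (1 / n) + (b (s (i + 1)) - b (s i)))| ≤
        |r i| * (1 / c₀) + |c| * L * ε * (1 / n) * (1 / c₀) +
          K * (3 * (|r i| ^ 2 + Cσ ^ 2 * (b (s (i + 1)) - b (s i)) ^ 2 +
            (|c| * Cσ) ^ 2 * (1 / n) ^ 2)) := by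
      intro i hi
      have hi := Finset.mem_range.1 hi
      have hσi := hc₀.trans_le (hσ (x (s i)))
      have htay := abs_sub_sub_deriv_mul_le hG hK (x (s i)) (x (s (i + 1)))
      have hinv : 1 / σ (x (s i)) ≤ 1 / c₀ := one_div_le_one_div_of_le hc₀ (hσ _)
      -- Dividing the increment of `x` by `σ (x (s i))` produces `c/n` and the increment of `b`
      -- exactly; what remains is the Saks-Henstock error, the drift error and the Taylor remainder.
      have hdecomp : G (x (s (i + 1))) - G (x (s i)) - (c * (1 / n) + (b (s (i + 1)) - b (s i))) =
          r i * (1 / σ (x (s i))) + (d i - c * σ (x (s i)) * (1 / n)) * (1 / σ (x (s i))) +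
          (G (x (s (i + 1))) - G (x (s i)) -
            1 / σ (x (s i)) * (x (s (i + 1)) - x (s i))) := by
        rw [hinc i hi]
        field_simp
        ring
      rw [hdecomp]
      have hsq : (x (s (i + 1)) - x (s i)) ^ 2 ≤
          3 * (|r i| ^ 2 + Cσ ^ 2 * (b (s (i + 1)) - b (s i)) ^ 2 +
            (|c| * Cσ) ^ 2 * (1 / n) ^ 2) := by
        rw [hinc i hi]
        have h1 : (σ (x (s i)) * (b (s (i + 1)) - b (s i))) ^ 2 ≤
            Cσ ^ 2 * (b (s (i + 1)) - b (s i)) ^ 2 := by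
          rw [mul_pow]
          gcongr
          exact hCσ _
        have h2 : d i ^ 2 ≤ (|c| * Cσ) ^ 2 * (1 / n) ^ 2 := by
          rw [← mul_pow, ← sq_abs (d i)]
          exact pow_le_pow_left₀ (abs_nonneg _) (hd i hi) 2
        rw [sq_abs]
        have h3 : ∀ p q w : ℝ, (p + q + w) ^ 2 ≤ 3 * (p ^ 2 + q ^ 2 + w ^ 2) := fun p q w => by
          nlinarith [sq_nonneg (p - q), sq_nonneg (q - w), sq_nonneg (p - w)]
        refine (h3 _ _ _).trans ?_
        linarith
      refine (abs_add_le _ _).trans (add_le_add ((abs_add_le _ _).trans (add_le_add ?_ ?_))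
        (htay.trans (mul_le_mul_of_nonneg_left hsq hK0)))
      · rw [abs_mul, abs_of_pos (by positivity : 0 < 1 / σ (x (s i)))]
        gcongr
      · rw [abs_mul, abs_of_pos (by positivity : 0 < 1 / σ (x (s i)))]
        exact mul_le_mul (hd' i hi) hinv (by positivity) (by positivity)
    rw [htel]
    refine (Finset.abs_sum_le_sum_abs _ _).trans ((Finset.sum_le_sum hterm).trans ?_)
    have hsum : ∑ i ∈ Finset.range n, (|r i| * (1 / c₀) + |c| * L * ε * (1 / n) * (1 / c₀) +
          K * (3 * (|r i| ^ 2 + Cσ ^ 2 * (b (s (i + 1)) - b (s i)) ^ 2 +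
            (|c| * Cσ) ^ 2 * (1 / n) ^ 2))) =
        (∑ i ∈ Finset.range n, |r i|) * (1 / c₀) + n * (|c| * L * ε * (1 / n) * (1 / c₀)) +
          K * (3 * (∑ i ∈ Finset.range n, |r i| ^ 2 +
            Cσ ^ 2 * ∑ i ∈ Finset.range n, (b (s (i + 1)) - b (s i)) ^ 2 +
            n * ((|c| * Cσ) ^ 2 * (1 / n) ^ 2))) := by
      simp only [Finset.sum_add_distrib, Finset.mul_sum, Finset.sum_mul, mul_add,
        Finset.sum_const, Finset.card_range, nsmul_eq_mul]
      ring
    have hr2 : ∑ i ∈ Finset.range n, |r i| ^ 2 ≤ ε ^ 2 :=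
      (Finset.sum_sq_le_sq_sum_of_nonneg fun i _ => abs_nonneg _).trans (by gcongr)
    have e1 : (n : ℝ) * (|c| * L * ε * (1 / n) * (1 / c₀)) = |c| * L * ε * (1 / c₀) := by
      field_simp
    have e2 : (n : ℝ) * ((|c| * Cσ) ^ 2 * (1 / n) ^ 2) = (|c| * Cσ) ^ 2 * (1 / n) := by
      field_simp
    rw [hsum, e1, e2]
    gcongr
  have hlim : Filter.Tendsto (fun ε : ℝ => ε * (1 / c₀) + |c| * L * ε * (1 / c₀) +
      K * (3 * (ε ^ 2 + Cσ ^ 2 * ε + (|c| * Cσ) ^ 2 * ε))) (nhdsWithin 0 (Set.Ioi 0)) (nhds 0) := by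
    refine (Continuous.tendsto' ?_ 0 0 ?_).mono_left nhdsWithin_le_nhds
    · fun_prop
    · simp
  exact ge_of_tendsto hlim (Filter.eventually_of_mem self_mem_nhdsWithin bound)

/-! ### Quadratic variation of fractional Brownian motion -/

namespace IsFractionalBrownianMotion

variable {Ω : Type*} [MeasurableSpace Ω] {μ : Measure Ω} {H : ℝ}
  {B : ℝ → Ω → ℝ}

lemma memLp_two (hB : IsFractionalBrownianMotion μ H B) {t : ℝ} (ht : t ∈ Set.Icc (0 : ℝ) 1) :
    MemLp (B t) 2 μ :=
  (hB.gaussian.hasGaussianLaw_eval ⟨t, ht⟩).memLp_two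

variable [IsProbabilityMeasure μ]

lemma ae_eq_zero (hB : IsFractionalBrownianMotion μ H B) (hH : 0 < H) : ∀ᵐ ω ∂μ, B 0 ω = 0 := by
  have h0 : (0 : ℝ) ∈ Set.Icc (0 : ℝ) 1 := by simp
  have hvar : Var[B 0; μ] = 0 := by
    rw [← covariance_self (hB.measurable 0 h0).aemeasurable, hB.covariance_eq 0 h0 0 h0]
    simp [Real.zero_rpow (by positivity : 2 * H ≠ 0)]
  filter_upwards [ae_eq_integral_of_variance_eq_zero (hB.memLp_two h0) hvar] with ω hω
  rw [hω, hB.centered 0 h0]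

lemma integral_sq_sub (hB : IsFractionalBrownianMotion μ H B) (hH : 0 < H) {s t : ℝ}
    (hs : s ∈ Set.Icc (0 : ℝ) 1) (ht : t ∈ Set.Icc (0 : ℝ) 1) :
    ∫ ω, (B t ω - B s ω) ^ 2 ∂μ = |t - s| ^ (2 * H) := by
  have hs2 := hB.memLp_two hs
  have ht2 := hB.memLp_two ht
  have hmean : ∫ ω, (B t - B s) ω ∂μ = 0 := by
    simp only [Pi.sub_apply]
    rw [integral_sub (ht2.integrable (by norm_num)) (hs2.integrable (by norm_num)),
      hB.centered s hs, hB.centered t ht, sub_zero]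
  have := variance_of_integral_eq_zero (ht2.sub hs2).aemeasurable hmean
  simp only [Pi.sub_apply] at this
  rw [← this, variance_sub ht2 hs2, ← covariance_self ht2.aemeasurable,
    ← covariance_self hs2.aemeasurable, hB.covariance_eq t ht t ht, hB.covariance_eq s hs s hs,
    hB.covariance_eq t ht s hs, abs_sub_comm s t]
  simp only [sub_self, abs_zero, Real.zero_rpow (by positivity : 2 * H ≠ 0)]
  ring

/-- The mean quadratic variation along the uniform partition into `n` intervals is `n ^ (1 - 2H)`. -/
lemma lintegral_uniformQuadVar (hB : IsFractionalBrownianMotion μ H B) (hH : 0 < H) {n : ℕ}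
    (hn : 0 < n) :
    ∫⁻ ω, ENNReal.ofReal (uniformQuadVar (fun t => B t ω) n) ∂μ =
      ENNReal.ofReal ((n : ℝ) ^ (-(2 * H - 1))) := by
  have hn0 : (0 : ℝ) < n := by exact_mod_cast hn
  have hmem : ∀ i ≤ n, (i : ℝ) / n ∈ Set.Icc (0 : ℝ) 1 := fun i hi =>
    ⟨by positivity, by rw [div_le_one hn0]; exact_mod_cast hi⟩
  have hInt : ∀ i ∈ Finset.range n,
      Integrable (fun ω => (B ((i + 1 : ℕ) / n) ω - B (i / n) ω) ^ 2) μ := fun i hi =>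
    ((hB.memLp_two (hmem _ (Finset.mem_range.1 hi))).sub
      (hB.memLp_two (hmem _ (Finset.mem_range.1 hi).le))).integrable_sq
  rw [← ofReal_integral_eq_lintegral_ofReal]
  · congr 1
    simp only [uniformQuadVar]
    rw [integral_finsetSum _ hInt, Finset.sum_congr rfl fun i hi =>
      hB.integral_sq_sub hH (hmem _ (Finset.mem_range.1 hi).le) (hmem _ (Finset.mem_range.1 hi))]
    have hstep : ∀ i : ℕ, |((i + 1 : ℕ) : ℝ) / n - i / n| = (n : ℝ)⁻¹ := fun i => by
      rw [← sub_div]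
      push_cast
      rw [add_sub_cancel_left, one_div, abs_of_pos (by positivity)]
    simp only [hstep, Finset.sum_const, Finset.card_range, nsmul_eq_mul]
    rw [Real.inv_rpow hn0.le, ← Real.rpow_neg hn0.le]
    nth_rewrite 1 [← Real.rpow_one (n : ℝ)]
    rw [← Real.rpow_add hn0]
    congr 1
    ring
  · exact integrable_finsetSum _ hInt
  · exact Filter.Eventually.of_forall fun ω => Finset.sum_nonneg fun i _ => sq_nonneg _

/-- By Fatou the lower limit of the quadratic variations has integral zero, so it vanishes almost
surely; almost sure convergence of the full sequence is not needed. -/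
lemma ae_frequently_uniformQuadVar_lt (hB : IsFractionalBrownianMotion μ H B) (hH : 1 / 2 < H) :
    ∀ᵐ ω ∂μ, ∀ ε > 0, ∃ᶠ n in Filter.atTop, uniformQuadVar (fun t => B t ω) n < ε := by
  set Q : ℕ → Ω → ENNReal := fun n ω => ENNReal.ofReal (uniformQuadVar (fun t => B t ω) (n + 1))
    with hQ
  have hmeas : ∀ n, Measurable (Q n) := by
    intro n
    have hmem : ∀ i ≤ n + 1, (i : ℝ) / (n + 1 : ℕ) ∈ Set.Icc (0 : ℝ) 1 := fun i hi =>
      ⟨by positivity, by rw [div_le_one (by positivity)]; exact_mod_cast hi⟩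
    refine ENNReal.measurable_ofReal.comp (Finset.measurable_sum _ fun i hi => ?_)
    exact ((hB.measurable _ (hmem _ (Finset.mem_range.1 hi))).sub
      (hB.measurable _ (hmem _ (Finset.mem_range.1 hi).le))).pow_const 2
  have hlim : Filter.Tendsto (fun n => ∫⁻ ω, Q n ω ∂μ) Filter.atTop (nhds 0) := by
    simp only [hQ]
    simp_rw [fun n : ℕ => hB.lintegral_uniformQuadVar (by linarith) n.succ_pos]
    rw [← ENNReal.ofReal_zero]
    refine ENNReal.tendsto_ofReal ?_
    exact ((tendsto_rpow_neg_atTop (by linarith : 0 < 2 * H - 1)).comp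
      tendsto_natCast_atTop_atTop).comp (Filter.tendsto_add_atTop_nat 1)
  have hzero : ∫⁻ ω, Filter.liminf (fun n => Q n ω) Filter.atTop ∂μ = 0 :=
    le_antisymm ((lintegral_liminf_le hmeas).trans_eq hlim.liminf_eq) zero_le
  rw [lintegral_eq_zero_iff (Measurable.liminf hmeas)] at hzero
  filter_upwards [hzero] with ω hω ε hε
  have h := Filter.frequently_lt_of_liminf_lt (f := Filter.atTop) (u := fun n => Q n ω)
    (b := ENNReal.ofReal ε) (by isBoundedDefault) (by rw [hω]; simpa using hε)
  have h' : ∃ᶠ n : ℕ in Filter.atTop, uniformQuadVar (fun t => B t ω) (n + 1) < ε :=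
    h.mono fun n hn => (ENNReal.ofReal_lt_ofReal_iff hε).1 hn
  exact (Filter.tendsto_add_atTop_nat 1).frequently h'

end IsFractionalBrownianMotion

/-! ### Inverting the transform and conditioning on the grid -/

/-- A function with derivative bounded below by `m > 0` expands distances by `m`. -/
lemma mul_abs_sub_le_of_le_hasDerivAt {G G' : ℝ → ℝ} {m : ℝ}
    (hG : ∀ x, HasDerivAt G (G' x) x) (hG' : ∀ x, m ≤ G' x) (x y : ℝ) :
    m * |x - y| ≤ |G x - G y| := by
  wlog hxy : y ≤ x generalizing x y
  · rw [abs_sub_comm x, abs_sub_comm (G x)]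
    exact this y x (le_of_not_ge hxy)
  have := mul_sub_le_image_sub_of_le_deriv (f := G) (fun z => (hG z).differentiableAt)
    (fun z => by rw [(hG z).deriv]; exact hG' z) hxy
  rw [abs_of_nonneg (sub_nonneg.2 hxy)]
  exact this.trans (le_abs_self _)

/-- A measurable left inverse of an injective continuous function on the line. -/
lemma exists_measurable_leftInverse {G : ℝ → ℝ} (hG : Continuous G)
    (hinj : Function.Injective G) : ∃ F : ℝ → ℝ, Measurable F ∧ ∀ x, F (G x) = x := by
  -- A continuous injection between Polish spaces is a measurable embedding (Lusin-Souslin), so its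
  -- inverse on the range extends measurably.
  obtain ⟨F, hF, hFG⟩ := (hG.measurableEmbedding hinj).exists_measurable_extend measurable_id
    fun _ => ⟨0⟩
  exact ⟨F, hF, congrFun hFG⟩

/-- Commuting coefficients are proportional. -/
lemma exists_eq_const_mul_of_commute {a σ : ℝ → ℝ} (ha : Differentiable ℝ a)
    (hσ : Differentiable ℝ σ) (h0 : ∀ x, σ x ≠ 0)
    (hcomm : ∀ x, deriv a x * σ x - a x * deriv σ x = 0) : ∃ c, ∀ x, a x = c * σ x := by
  have hd : ∀ x, HasDerivAt (fun y => a y / σ y) 0 x := fun x => by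
    have := (ha x).hasDerivAt.fun_div (hσ x).hasDerivAt (h0 x)
    rwa [hcomm x, zero_div] at this
  refine ⟨a 0 / σ 0, fun x => ?_⟩
  rw [← is_const_of_deriv_eq_zero (fun y => (hd y).differentiableAt) (fun y => (hd y).deriv) x 0,
    div_mul_cancel₀ _ (h0 x)]

lemma gridSigmaAlgebra_le {Ω : Type*} [mΩ : MeasurableSpace Ω] {B : ℝ → Ω → ℝ}
    (hB : ∀ t ∈ Set.Icc (0 : ℝ) 1, Measurable (B t)) (n : ℕ) : gridSigmaAlgebra B n ≤ mΩ := by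
  refine iSup₂_le fun i hi => (hB _ ⟨by positivity, ?_⟩).comap_le
  exact div_le_one_of_le₀ (by exact_mod_cast (Finset.mem_Icc.1 hi).2) (by positivity)

lemma measurable_gridSigmaAlgebra_one {Ω : Type*} (B : ℝ → Ω → ℝ) {n : ℕ} (hn : 1 ≤ n) :
    Measurable[gridSigmaAlgebra B n] (B 1) := by
  have h1 : ((n : ℝ) / n) = 1 := div_self (by positivity)
  rw [measurable_iff_comap_le]
  have := le_iSup₂ (f := fun (i : ℕ) (_ : i ∈ Finset.Icc 1 n) =>
    MeasurableSpace.comap (B ((i : ℝ) / (n : ℝ))) inferInstance) n (Finset.mem_Icc.2 ⟨hn, le_rfl⟩)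
  simp only [h1] at this
  exact this

theorem corollary1 {Ω : Type*} [MeasurableSpace Ω] (μ : Measure Ω) [IsProbabilityMeasure μ]
    (H : ℝ) (hH : 1 / 2 < H) (hH1 : H < 1)
    (a σ : ℝ → ℝ) (hcoef : CoefficientAssumptions a σ) (x₀ : ℝ)
    (B X : ℝ → Ω → ℝ) (hB : IsFractionalBrownianMotion μ H B)
    (hX : IsPathwiseSolution μ a σ x₀ B X)
    (hcomm : ∀ x : ℝ, deriv a x * σ x - a x * deriv σ x = 0) :
    (∃ φ : ℝ → ℝ, Measurable φ ∧ X 1 =ᵐ[μ] fun ω => φ (B 1 ω)) ∧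
    MemLp (X 1) 2 μ ∧
    ∀ n : ℕ, 1 ≤ n →
      optimalApprox μ B X n =ᵐ[μ] X 1 ∧
      (∫ ω, |X 1 ω - optimalApprox μ B X n ω| ^ 2 ∂μ) ^ (1 / 2 : ℝ) = 0 := by
  have h1 : (1 : ℝ) ∈ Set.Icc (0 : ℝ) 1 := by simp
  obtain ⟨c₀, hc₀, hσ⟩ := hcoef.inf_pos
  obtain ⟨Cσ, hCσ⟩ := hcoef.bounded_σ
  have hCσ' : ∀ y, σ y ≤ Cσ := fun y => (le_abs_self _).trans (hCσ y)
  have hσ0 : ∀ y, 0 < σ y := fun y => hc₀.trans_le (hσ y)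
  have hCσ0 : 0 < Cσ := (hσ0 0).trans_le (hCσ' 0)
  have hdσ : Differentiable ℝ σ := hcoef.contDiff_σ.differentiable (by norm_num)
  obtain ⟨L, hL⟩ := hcoef.bounded_deriv_σ 1 le_rfl (by norm_num)
  have hLip : ∀ y z, |σ y - σ z| ≤ L * |y - z| := fun y z =>
    convex_univ.norm_image_sub_le_of_norm_deriv_le (f := σ) (fun w _ => hdσ w)
      (fun w _ => by simpa [iteratedDeriv_one] using hL w) (Set.mem_univ z) (Set.mem_univ y)
  obtain ⟨c, hc⟩ := exists_eq_const_mul_of_commute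
    (hcoef.contDiff_a.differentiable (by norm_num)) hdσ (fun y => (hσ0 y).ne') hcomm
  set G : ℝ → ℝ := fun y => ∫ z in x₀..y, 1 / σ z
  have hGc : Continuous fun z => 1 / σ z :=
    continuous_const.div hdσ.continuous fun y => (hσ0 y).ne'
  have hG : ∀ y, HasDerivAt G (1 / σ y) y := fun y =>
    intervalIntegral.integral_hasDerivAt_right (hGc.intervalIntegrable _ _)
      (hGc.stronglyMeasurableAtFilter _ _) hGc.continuousAt
  -- This expansion by `1 / Cσ` yields both the injectivity of `G` and the square integrability of
  -- `X 1`.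
  have hexp := mul_abs_sub_le_of_le_hasDerivAt hG
    fun y => one_div_le_one_div_of_le (hσ0 y) (hCσ' y)
  have hinj : Function.Injective G := fun y z hyz => by
    have h := hexp y z
    rw [hyz, sub_self, abs_zero] at h
    have := nonpos_of_mul_nonpos_right h (one_div_pos.2 hCσ0)
    exact sub_eq_zero.1 (abs_nonpos_iff.1 this)
  obtain ⟨F, hF, hFG⟩ := exists_measurable_leftInverse
    (continuous_iff_continuousAt.2 fun y => (hG y).continuousAt) hinj
  have hGx₀ : G x₀ = 0 := intervalIntegral.integral_same
  have hGX : ∀ᵐ ω ∂μ, G (X 1 ω) = c + B 1 ω := by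
    filter_upwards [hX.continuous, hX.equation, hB.ae_frequently_uniformQuadVar_lt hH,
      hB.ae_eq_zero (by linarith)] with ω hxc hxe hb hb0
    have := change_of_variables (c := c) hc₀ hσ hCσ' hLip hG hxc
      (by simpa only [hc] using hxe) hb
    rw [hGx₀, hb0] at this
    linarith
  have hφm : Measurable fun y => F (c + y) := hF.comp (measurable_const_add c)
  have hXφ : X 1 =ᵐ[μ] fun ω => F (c + B 1 ω) := by
    filter_upwards [hGX] with ω hω
    rw [← hω, hFG]
  have hLp : MemLp (X 1) 2 μ := by
    -- The expansion of `G` gives `|X 1 - x₀| ≤ Cσ * |c + B 1|`, with a Gaussian right side.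
    have hB1 : MemLp (fun ω => Cσ * (c + B 1 ω)) 2 μ :=
      ((memLp_const c).add (hB.memLp_two h1)).const_mul Cσ
    have hsub : MemLp (fun ω => X 1 ω - x₀) 2 μ := by
      refine hB1.mono ((hX.measurable 1 h1).sub_const x₀).aestronglyMeasurable ?_
      filter_upwards [hGX] with ω hω
      have h := hexp (X 1 ω) x₀
      rw [hω, hGx₀, sub_zero, one_div, inv_mul_le_iff₀ hCσ0] at h
      rwa [norm_mul, Real.norm_eq_abs, Real.norm_eq_abs, Real.norm_eq_abs, abs_of_pos hCσ0]
    exact (memLp_congr_ae (.of_forall fun ω => by simp)).1 (hsub.add (memLp_const x₀))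
  refine ⟨⟨_, hφm, hXφ⟩, hLp, fun n hn => ?_⟩
  have hle := gridSigmaAlgebra_le hB.measurable n
  have hcond : optimalApprox μ B X n =ᵐ[μ] X 1 := by
    have hInt : Integrable (fun ω => F (c + B 1 ω)) μ :=
      (hLp.integrable (by norm_num)).congr hXφ
    have hsm : StronglyMeasurable[gridSigmaAlgebra B n] (fun ω => F (c + B 1 ω)) :=
      (hφm.comp (measurable_gridSigmaAlgebra_one B hn)).stronglyMeasurable
    refine (condExp_congr_ae hXφ).trans ?_
    rw [condExp_of_stronglyMeasurable hle hsm hInt]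
    exact hXφ.symm
  refine ⟨hcond, ?_⟩
  have hzero : ∫ ω, |X 1 ω - optimalApprox μ B X n ω| ^ 2 ∂μ = 0 := by
    refine integral_eq_zero_of_ae ?_
    filter_upwards [hcond] with ω hω
    simp [hω]
  rw [hzero, Real.zero_rpow (by norm_num)]
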